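/- Let $N\ge 0$, $I=\{0,\dots,N,*\}$, and let $\alpha=(\alpha_{m,n})_{0\le n<m\le N}$ be the step sizes of the method $x_i=x_0-\sum_{k=0}^{i-1}\alpha_{i,k}g_k$, $1\le i\le N$. In $\mathbb{R}^{N+2}$ put $h_i=(-\alpha_{i,0},\dots,-\alpha_{i,i-1},0,\dots,0,1)^\top$ and $u_i=e_{i+1}$ for $0\le i\le N$, and $h_*=u_*=0$. When paired with a vector of $\mathbb{R}^{N+1}$, $u_i$ stands for its first $N+1$ coordinates. Let $R\in\mathbb{R}$, $b\in\mathbb{R}^{N+1}$, $C,A_R\in\mathbb{S}^{N+2}$, $\mu_i\in\mathbb{R}$ and $\beta_{i,j}\in\mathbb{R}^{10}$ ($i,j\in I$) be given, and let $A_{i,j}(\alpha)=\tfrac12(Z_{i,j}+Z_{i,j}^\top)$ with $$Z_{i,j}=\beta^{(1)}_{i,j}h_ih_i^\top+\beta^{(2)}_{i,j}h_ih_j^\top+\beta^{(3)}_{i,j}h_jh_j^\top+\beta^{(4)}_{i,j}u_iu_i^\top+\beta^{(5)}_{i,j}u_iu_j^\top+\beta^{(6)}_{i,j}u_ju_j^\top+\beta^{(7)}_{i,j}u_ih_i^\top+\beta^{(8)}_{i,j}u_ih_j^\top+\beta^{(9)}_{i,j}u_jh_i^\top+\beta^{(10)}_{i,j}u_jh_j^\top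 .$$ Consider the performance estimation problem $$w^{\mathrm{SDP}}(\alpha)=\sup_{F\in\mathbb{R}^{N+1},\,G\in\mathbb{S}^{N+2}}\Big\{b^\top F+\mathrm{Tr}(CG)\;:\;F^\top(\mu_iu_i-\mu_ju_j)\ge \mathrm{Tr}(A_{i,j}(\alpha)G)\ \forall i,j\in I,\ \mathrm{Tr}(A_RG)\le R^2,\ G\succeq0\Big\}$$ and its dual $$w^{\mathrm{dual}}(\alpha)=\inf_{\tau\ge 0,\ \lambda_{i,j}\ge 0\,(i,j\in I)}\Big\{\tau R^2\;:\;\mathcal{A}(\tau,\lambda,\alpha)\succeq0,\ b-\sum_{i,j\in I}\lambda_{i,j}(\mu_ju_j-\mu_iu_i)=0\Big\},$$ $$\mathcal{A}(\tau,\lambda,\alpha)=\tau A_R-C+\sum_{i,j\in I}\lambda_{i,j}A_{i,j}(\alpha).$$ Suppose that $w^{\mathrm{dual}}$ is differentiable at $\alpha$ (finite near $\alpha$ and differentiable there), and that the primal problem at $\alpha$ has an optimal solution $(F,G)$ whose Gram matrix $G$ is unique, that is, every optimal solution has the same $G$. Then, for every optimal solution $(\tau,\lambda)$ of the dual problem at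 $\alpha$, the gradient of $w^{\mathrm{dual}}$ is $\nabla w^{\mathrm{dual}}(\alpha)=\big(\tfrac{\partial w^{\mathrm{dual}}}{\partial\alpha_{1,0}}(\alpha),\dots,\tfrac{\partial w^{\mathrm{dual}}}{\partial\alpha_{N,N-1}}(\alpha)\big)$, with $$\frac{\partial w^{\mathrm{dual}}}{\partial\alpha_{m,n}}(\alpha)=\mathrm{Tr}\Big(-G\,\frac{\partial\mathcal{A}}{\partial\alpha_{m,n}}(\tau,\lambda,\alpha)\Big),\qquad 0\le n<m\le N,$$ where $\partial\mathcal{A}/\partial\alpha_{m,n}$ is the entrywise partial derivative of $\mathcal{A}$ with $\tau,\lambda$ held fixed. Moreover $w^{\mathrm{SDP}}$ is also finite near $\alpha$ and differentiable at $\alpha$, and its gradient is given by the same formula. -/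

import Mathlib

open scoped Matrix Topology

noncomputable section

namespace PEP

/-- Index set of the step sizes `α_{m,n}`, `0 ≤ n < m ≤ N`. -/
abbrev StepIdx (N : ℕ) : Type := {p : Fin (N + 1) × Fin (N + 1) // p.2 < p.1}

/-- The space of step sizes `α = (α_{m,n})`, with its Euclidean structure. -/
abbrev Steps (N : ℕ) : Type := EuclideanSpace ℝ (StepIdx N)

/-- The index set `I = {0, …, N, *}`; the index `*` is `none`. -/
abbrev Idx (N : ℕ) : Type := Option (Fin (N + 1))

/-- Real square matrices of size `N + 2`. -/
abbrev Mat (N : ℕ) : Type := Matrix (Fin (N + 2)) (Fin (N + 2)) ℝ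

/-- `h_i = (-α_{i,0}, …, -α_{i,i-1}, 0, …, 0, 1)` and `h_* = 0`: the coordinates of the iterate
`x_i = x_0 - ∑_{k < i} α_{i,k} g_k` in the family `g_0, …, g_N, x_0`. -/
def hvec {N : ℕ} (α : Steps N) : Idx N → Fin (N + 2) → ℝ
  | none => 0
  | some i =>
      Fin.snoc (α := fun _ => ℝ) (fun k : Fin (N + 1) => if hk : k < i then -α ⟨(i, k), hk⟩ else 0) 1

/-- `u_i`, the coordinates of `g_i` in the family `g_0, …, g_N, x_0`, and `u_* = 0`. -/
def uvec {N : ℕ} : Idx N → Fin (N + 2) → ℝ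
  | none => 0
  | some i => Pi.single i.castSucc 1

/-- The same unit vectors in `ℝ^{N+1}`, acting on `F = (f_0, …, f_N)`, so that
`F ⬝ᵥ fvec i = f_i` and `F ⬝ᵥ fvec * = 0`. -/
def fvec {N : ℕ} : Idx N → Fin (N + 1) → ℝ
  | none => 0
  | some i => Pi.single i 1

/-- The data of a performance estimation problem of an `N`-step fixed-step first-order method:
the radius `R`, the performance criterion `b ⬝ F + Tr (C G)`, the matrix `A_R` of the initial
condition `Tr (A_R G) ≤ R ^ 2`, and the scalars `μ_i` and coefficients
`β_{i,j} = (β_{i,j}^{(1)}, …, β_{i,j}^{(10)})` (numbered from `0` here) of the interpolation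
conditions. -/
structure Data (N : ℕ) where
  R : ℝ
  b : Fin (N + 1) → ℝ
  C : Mat N
  AR : Mat N
  μ : Idx N → ℝ
  β : Idx N → Idx N → Fin 10 → ℝ

variable {N : ℕ}

/-- The matrix `Z_{i,j}(h_i, h_j)`. -/
def Data.Z (D : Data N) (α : Steps N) (i j : Idx N) : Mat N :=
  let v (x y : Fin (N + 2) → ℝ) : Mat N := Matrix.vecMulVec x y
  let h : Idx N → Fin (N + 2) → ℝ := hvec α
  let u : Idx N → Fin (N + 2) → ℝ := uvec
  let β := D.β i j
  β 0 • v (h i) (h i) + β 1 • v (h i) (h j) + β 2 • v (h j) (h j)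
    + β 3 • v (u i) (u i) + β 4 • v (u i) (u j) + β 5 • v (u j) (u j)
    + β 6 • v (u i) (h i) + β 7 • v (u i) (h j) + β 8 • v (u j) (h i) + β 9 • v (u j) (h j)

/-- `A_{i,j}(α) = (Z_{i,j} + Z_{i,j}ᵀ) / 2`. -/
def Data.A (D : Data N) (α : Steps N) (i j : Idx N) : Mat N :=
  (1 / 2 : ℝ) • (D.Z α i j + (D.Z α i j)ᵀ)

/-- Feasibility of `(F, G)` for the primal semidefinite program. -/
structure Data.PrimalFeasible (D : Data N) (α : Steps N) (F : Fin (N + 1) → ℝ) (G : Mat N) :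
    Prop where
  interp : ∀ i j : Idx N,
    (D.A α i j * G).trace ≤ F ⬝ᵥ (D.μ i • fvec i - D.μ j • fvec j)
  init : (D.AR * G).trace ≤ D.R ^ 2
  psd : G.PosSemidef

/-- The objective `bᵀ F + Tr (C G)` of the primal semidefinite program. -/
def Data.primalObj (D : Data N) (F : Fin (N + 1) → ℝ) (G : Mat N) : ℝ :=
  D.b ⬝ᵥ F + (D.C * G).trace

/-- `(F, G)` is an optimal solution of the primal semidefinite program. -/
def Data.IsPrimalSolution (D : Data N) (α : Steps N) (F : Fin (N + 1) → ℝ) (G : Mat N) : Prop :=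
  D.PrimalFeasible α F G ∧
    ∀ F' G', D.PrimalFeasible α F' G' → D.primalObj F' G' ≤ D.primalObj F G

/-- `G` is the unique optimal Gram matrix of the primal semidefinite program. -/
def Data.IsUniqueOptimalGram (D : Data N) (α : Steps N) (G : Mat N) : Prop :=
  (∃ F, D.IsPrimalSolution α F G) ∧ ∀ F' G', D.IsPrimalSolution α F' G' → G' = G

/-- The optimal value of the primal semidefinite program, in `[-∞, +∞]`. -/
def Data.wSDP (D : Data N) (α : Steps N) : EReal :=
  ⨆ (F : Fin (N + 1) → ℝ) (G : Mat N) (_ : D.PrimalFeasible α F G), (D.primalObj F G : EReal)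

/-- `𝒜(τ, λ, α) = τ A_R - C + ∑_{i,j} λ_{i,j} A_{i,j}(α)`. -/
def Data.calA (D : Data N) (τ : ℝ) (lam : Idx N → Idx N → ℝ) (α : Steps N) : Mat N :=
  τ • D.AR - D.C + ∑ i, ∑ j, lam i j • D.A α i j

/-- Feasibility of `(τ, λ)` for the dual problem. -/
structure Data.DualFeasible (D : Data N) (α : Steps N) (τ : ℝ) (lam : Idx N → Idx N → ℝ) :
    Prop where
  psd : (D.calA τ lam α).PosSemidef
  eq : D.b - ∑ i, ∑ j, lam i j • (D.μ j • fvec j - D.μ i • fvec i) = 0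
  lam_nonneg : ∀ i j, 0 ≤ lam i j
  tau_nonneg : 0 ≤ τ

/-- The optimal value `w^dual(α)` of the dual problem, in `[-∞, +∞]`. -/
def Data.wDual (D : Data N) (α : Steps N) : EReal :=
  ⨅ (τ : ℝ) (lam : Idx N → Idx N → ℝ) (_ : D.DualFeasible α τ lam), ((τ * D.R ^ 2 : ℝ) : EReal)

/-- `(τ, λ)` is an optimal solution of the dual problem. -/
def Data.IsDualSolution (D : Data N) (α : Steps N) (τ : ℝ) (lam : Idx N → Idx N → ℝ) : Prop :=
  D.DualFeasible α τ lam ∧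
    ∀ τ' lam', D.DualFeasible α τ' lam' → τ * D.R ^ 2 ≤ τ' * D.R ^ 2

/-- The partial derivative `∂f/∂α_{m,n}` at `α`, where `p = (m, n)`. -/
def partialDeriv (f : Steps N → ℝ) (p : StepIdx N) (α : Steps N) : ℝ :=
  deriv (fun t : ℝ => f (α + t • EuclideanSpace.single p (1 : ℝ))) 0

/-- The entrywise partial derivative `∂𝒜/∂α_{m,n}` at `(τ, λ, α)`, where `p = (m, n)`. -/
def Data.dcalA (D : Data N) (τ : ℝ) (lam : Idx N → Idx N → ℝ) (p : StepIdx N) (α : Steps N) :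
    Mat N :=
  Matrix.of fun r s => partialDeriv (fun a => D.calA τ lam a r s) p α

/-- An extended-real-valued function is differentiable at `α` with gradient `v`: it is finite
near `α`, and as a real function it has the gradient `v` at `α`. -/
def HasGradient (f : Steps N → EReal) (v : Steps N) (α : Steps N) : Prop :=
  (∀ᶠ a in 𝓝 α, f a ≠ ⊥ ∧ f a ≠ ⊤) ∧ HasGradientAt (fun a => (f a).toReal) v α

end PEP

end

/-!
The primal program sees `F` only through the products `μ_i F_i`, so `F` may be restricted to the
coordinates with `μ_i ≠ 0`; dual feasibility forces `b_i = 0` at the others. On the resulting closed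
cone, uniqueness of the optimal Gram matrix makes the recession cone of the primal superlevel sets
trivial (`Data.eq_zero_of_recession`). By compactness of the unit sphere this persists, with uniform
bounds, for all step sizes near `α` (`exists_mul_norm_le_excess`), and it has two consequences.

There is no duality gap near `α` (`Data.eventually_wSDP_eq_wDual`): a trivial recession cone makes
the cone of attainable constraint and objective values closed, and a separating hyperplane is a dual
solution (`exists_dual_le`). Hence `wSDP` and `wDual` agree near `α`.

Nearly optimal primal points at step sizes tending to `α` stay bounded, and their Gram matrices tend
to `G`. Inserting such a point `(F', G')` at `α' = α + s d` into the Lagrangian of the optimal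
multipliers `(τ, λ)` at `α` gives `wDual α' - wDual α ≤ -Tr ((𝒜(α') - 𝒜(α)) G') + s²`. As `s → 0+`,
the derivative of `wDual` along `d` is at most `-Tr (∂_d 𝒜 G)` (`Data.deriv_wDual_le`). Since `wDual`
is differentiable, `d` and `-d` together give equality.
-/

noncomputable section

namespace PEP

open Filter Set

variable {N : ℕ}

/-! ### Closed cones with trivial recession -/

section Cone

variable {E κ : Type*} [NormedAddCommGroup E] [NormedSpace ℝ E] [FiniteDimensional ℝ E] [Fintype κ]

/-- The total violation of the homogeneous system `a k ≤ 0` for all `k`, `0 ≤ c`. -/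
def excess (a : κ → ℝ) (c : ℝ) : ℝ := ∑ k, max (a k) 0 + max (-c) 0

lemma excess_nonpos {a : κ → ℝ} {c : ℝ} (h : excess a c ≤ 0) : (∀ k, a k ≤ 0) ∧ 0 ≤ c := by
  have h1 : ∀ k, 0 ≤ max (a k) 0 := fun k => le_max_right _ _
  have h2 : 0 ≤ ∑ k, max (a k) 0 := Finset.sum_nonneg fun k _ => h1 k
  have h3 : 0 ≤ max (-c) 0 := le_max_right _ _
  unfold excess at h
  refine ⟨fun k => ?_, ?_⟩
  · have h4 := Finset.single_le_sum (fun k _ => h1 k) (Finset.mem_univ k)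
    have h5 := le_max_left (a k) 0
    linarith
  · have h5 := le_max_left (-c) 0
    linarith

lemma excess_mono {a a' : κ → ℝ} {c c' : ℝ} (h : ∀ k, a k ≤ a' k) (hc : c' ≤ c) :
    excess a c ≤ excess a' c' := by
  unfold excess
  gcongr with k
  exact h k

lemma excess_mul {t : ℝ} (ht : 0 ≤ t) (a : κ → ℝ) (c : ℝ) :
    excess (fun k => t * a k) (t * c) = t * excess a c := by
  simp only [excess, mul_add, Finset.mul_sum, mul_max_of_nonneg _ _ ht, mul_zero, mul_neg]

lemma continuous_excess {X : Type*} [TopologicalSpace X] {a : X → κ → ℝ} {c : X → ℝ}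
    (ha : ∀ k, Continuous fun x => a x k) (hc : Continuous c) :
    Continuous fun x => excess (a x) (c x) := by
  unfold excess
  fun_prop

/-- If the homogeneous system `a p k x ≤ 0`, `0 ≤ c p x` has only the trivial solution in a closed
cone at the parameter `p₀`, then its violation grows linearly in `‖x‖`, uniformly for parameters
near `p₀`. -/
lemma exists_mul_norm_le_excess {P : Type*} [TopologicalSpace P] (K : ConvexCone ℝ E)
    (hK : IsClosed (K : Set E)) (a : P → κ → E →ₗ[ℝ] ℝ) (c : P → E →ₗ[ℝ] ℝ)
    (ha : ∀ k, Continuous fun q : P × E => a q.1 k q.2)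
    (hc : Continuous fun q : P × E => c q.1 q.2) (p₀ : P)
    (h : ∀ x ∈ K, (∀ k, a p₀ k x ≤ 0) → 0 ≤ c p₀ x → x = 0) :
    ∃ δ > 0, ∀ᶠ p in 𝓝 p₀, ∀ x ∈ K, δ * ‖x‖ ≤ excess (fun k => a p k x) (c p x) := by
  have hcont : Continuous fun q : P × E => excess (fun k => a q.1 k q.2) (c q.1 q.2) :=
    continuous_excess ha hc
  have hcomp : IsCompact ((K : Set E) ∩ Metric.sphere 0 1) := (isCompact_sphere 0 1).inter_left hK
  obtain ⟨δ, hδ, hmin⟩ := hcomp.exists_forall_le' (a := 0)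
    (f := fun x => excess (fun k => a p₀ k x) (c p₀ x))
    (hcont.comp (Continuous.prodMk_right p₀)).continuousOn (by
      rintro x ⟨hx, hx1⟩
      by_contra hle
      obtain ⟨h1, h2⟩ := excess_nonpos (not_lt.mp hle)
      rw [h x hx h1 h2] at hx1
      simp at hx1)
  refine ⟨δ / 2, by positivity, ?_⟩
  have key := hcomp.eventually_forall_of_forall_eventually (x₀ := p₀)
    (P := fun p x => δ / 2 < excess (fun k => a p k x) (c p x)) (by
      intro x hx
      exact hcont.continuousAt.eventually_const_lt (by have := hmin x hx; linarith))
  filter_upwards [key] with p hp x hx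
  rcases eq_or_ne x 0 with rfl | hx0
  · simp [excess]
  have hn : 0 < ‖x‖ := norm_pos_iff.mpr hx0
  have h1 := hp (‖x‖⁻¹ • x) ⟨K.smul_mem (inv_pos.mpr hn) hx, by simp [norm_smul, hn.ne']⟩
  simp only [map_smul, smul_eq_mul] at h1
  rw [excess_mul (inv_nonneg.mpr hn.le), inv_mul_eq_div, lt_div_iff₀ hn] at h1
  exact h1.le

/-- Points of a closed cone whose violation is bounded along converging parameters have a
convergent subsequence. -/
lemma exists_tendsto_subseq_of_excess_le {P : Type*} [TopologicalSpace P] (K : ConvexCone ℝ E)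
    (hK : IsClosed (K : Set E)) (a : P → κ → E →ₗ[ℝ] ℝ) (c : P → E →ₗ[ℝ] ℝ) {p₀ : P} {δ : ℝ}
    (hδ : 0 < δ)
    (h : ∀ᶠ p in 𝓝 p₀, ∀ x ∈ K, δ * ‖x‖ ≤ excess (fun k => a p k x) (c p x))
    {p : ℕ → P} (hp : Tendsto p atTop (𝓝 p₀)) {x : ℕ → E} (hx : ∀ n, x n ∈ K) {B : ℕ → ℝ} {B₀ : ℝ}
    (hBt : Tendsto B atTop (𝓝 B₀))
    (hB : ∀ n, excess (fun k => a (p n) k (x n)) (c (p n) (x n)) ≤ B n) :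
    ∃ x₀ ∈ K, ∃ φ : ℕ → ℕ, StrictMono φ ∧ Tendsto (x ∘ φ) atTop (𝓝 x₀) := by
  have hfreq : ∃ᶠ n in atTop, x n ∈ Metric.closedBall (0 : E) ((B₀ + 1) / δ) := by
    refine Eventually.frequently ?_
    filter_upwards [hp.eventually h, hBt.eventually_le_const (lt_add_one B₀)] with n hn hBn
    rw [mem_closedBall_zero_iff, le_div_iff₀ hδ, mul_comm]
    exact (hn _ (hx n)).trans ((hB n).trans hBn)
  obtain ⟨x₀, -, φ, hφ, ht⟩ := tendsto_subseq_of_frequently_bounded Metric.isBounded_closedBall hfreq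
  exact ⟨x₀, hK.mem_of_tendsto ht (Eventually.of_forall fun n => hx _), φ, hφ, ht⟩

/-- A Farkas lemma over a closed convex cone `K`. Since the system `l k x ≤ 0`, `0 ≤ m x` has only
the trivial solution in `K`, the cone of all `(u, z)` that dominate some `(l x, m x)` with `x ∈ K`
is closed, and it is separated from `(0, 1)`. -/
lemma exists_nonneg_forall_le_sum (K : ConvexCone ℝ E) (hK : IsClosed (K : Set E))
    (h0 : (0 : E) ∈ K) (l : κ → E →ₗ[ℝ] ℝ) (m : E →ₗ[ℝ] ℝ)
    (h : ∀ x ∈ K, (∀ k, l k x ≤ 0) → 0 ≤ m x → x = 0) :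
    ∃ lam : κ → ℝ, (∀ k, 0 ≤ lam k) ∧ ∀ x ∈ K, m x ≤ ∑ k, lam k * l k x := by
  classical
  have hlc : ∀ k, Continuous (l k) := fun k => (l k).continuous_of_finiteDimensional
  have hmc : Continuous m := m.continuous_of_finiteDimensional
  obtain ⟨δ, hδ, hco⟩ := exists_mul_norm_le_excess (P := Unit) K hK (fun _ => l) (fun _ => m)
    (fun k => (hlc k).comp continuous_snd) (hmc.comp continuous_snd) () h
  let T : Set ((κ → ℝ) × ℝ) := {y | ∃ x ∈ K, (∀ k, l k x ≤ y.1 k) ∧ y.2 ≤ m x}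
  have hTc : IsClosed T := by
    refine IsSeqClosed.isClosed fun y y₀ hy hyt => ?_
    choose x hxK hx1 hx2 using hy
    have ht1 : ∀ k, Tendsto (fun n => (y n).1 k) atTop (𝓝 (y₀.1 k)) := fun k =>
      (((continuous_apply k).comp continuous_fst).tendsto y₀).comp hyt
    have ht2 : Tendsto (fun n => (y n).2) atTop (𝓝 y₀.2) := (continuous_snd.tendsto y₀).comp hyt
    have hexc : Continuous fun y : (κ → ℝ) × ℝ => excess y.1 y.2 :=
      continuous_excess (fun k => by fun_prop) continuous_snd
    obtain ⟨x₀, hx₀, φ, hφ, ht⟩ := exists_tendsto_subseq_of_excess_le (P := Unit) K hK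
      (fun _ => l) (fun _ => m) hδ hco (p := fun _ => ()) tendsto_const_nhds hxK
      ((hexc.tendsto y₀).comp hyt) (fun n => excess_mono (hx1 n) (hx2 n))
    refine ⟨x₀, hx₀, fun k => ?_, ?_⟩
    · exact le_of_tendsto_of_tendsto' (((hlc k).tendsto x₀).comp ht)
        ((ht1 k).comp hφ.tendsto_atTop) fun n => hx1 (φ n) k
    · exact le_of_tendsto_of_tendsto' (ht2.comp hφ.tendsto_atTop) ((hmc.tendsto x₀).comp ht)
        fun n => hx2 (φ n)
  have hTadd : ∀ y ∈ T, ∀ y' ∈ T, y + y' ∈ T := by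
    rintro y ⟨x, hx, hx1, hx2⟩ y' ⟨x', hx', hx1', hx2'⟩
    refine ⟨x + x', K.add_mem hx hx', fun k => ?_, ?_⟩
    · simpa using add_le_add (hx1 k) (hx1' k)
    · simpa using add_le_add hx2 hx2'
  have hTsmul : ∀ t : ℝ, 0 < t → ∀ y ∈ T, t • y ∈ T := by
    rintro t ht y ⟨x, hx, hx1, hx2⟩
    refine ⟨t • x, K.smul_mem ht hx, fun k => ?_, ?_⟩
    · simpa using mul_le_mul_of_nonneg_left (hx1 k) ht.le
    · simpa using mul_le_mul_of_nonneg_left hx2 ht.le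
  have hT0 : (0 : (κ → ℝ) × ℝ) ∈ T := ⟨0, h0, by simp, by simp⟩
  have hTconv : Convex ℝ T := by
    intro y hy y' hy' s t hs ht _
    rcases hs.eq_or_lt with rfl | hs
    · rcases ht.eq_or_lt with rfl | ht
      · simpa using hT0
      · simpa using hTsmul t ht y' hy'
    · rcases ht.eq_or_lt with rfl | ht
      · simpa using hTsmul s hs y hy
      · exact hTadd _ (hTsmul s hs y hy) _ (hTsmul t ht y' hy')
  have hnot : ((0, 1) : (κ → ℝ) × ℝ) ∉ T := by
    rintro ⟨x, hx, hx1, hx2⟩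
    have hx2' : 1 ≤ m x := hx2
    have := h x hx (fun k => hx1 k) (by linarith)
    rw [this] at hx2'
    simp at hx2'
    linarith
  obtain ⟨f, u, hfu, huf⟩ := geometric_hahn_banach_closed_point hTconv hTc hnot
  have hu : 0 < u := by simpa using hfu 0 hT0
  have hneg : ∀ y ∈ T, f y ≤ 0 := by
    intro y hy
    by_contra! hpos
    have h1 := hfu _ (hTsmul (u / f y) (div_pos hu hpos) y hy)
    rw [map_smul, smul_eq_mul, div_mul_cancel₀ _ hpos.ne'] at h1
    exact lt_irrefl _ h1
  set s := f (0, 1) with hs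
  have hs0 : 0 < s := hu.trans huf
  refine ⟨fun k => -f (Pi.single k 1, 0) / s, fun k => ?_, fun x hx => ?_⟩
  · refine div_nonneg (neg_nonneg.mpr (hneg _ ⟨0, h0, fun j => ?_, by simp⟩)) hs0.le
    rcases eq_or_ne j k with rfl | hj <;> simp [*]
  · have h1 : f (fun k => l k x, m x) ≤ 0 := hneg _ ⟨x, hx, fun k => le_rfl, le_rfl⟩
    have h2 : ((fun k => l k x, m x) : (κ → ℝ) × ℝ)
        = ∑ k, l k x • ((Pi.single k 1, 0) : (κ → ℝ) × ℝ) + m x • ((0, 1) : (κ → ℝ) × ℝ) := by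
      ext j
      · simp [Prod.fst_sum, Finset.sum_apply, Pi.single_apply]
      · simp [Prod.snd_sum]
    rw [h2, map_add, map_sum, map_smul, smul_eq_mul, ← hs] at h1
    simp only [map_smul, smul_eq_mul] at h1
    have h3 : ∑ k, -f (Pi.single k 1, 0) / s * l k x
        = -(∑ k, l k x * f (Pi.single k 1, 0)) / s := by
      rw [neg_div, Finset.sum_div, ← Finset.sum_neg_distrib]
      exact Finset.sum_congr rfl fun k _ => by ring
    rw [h3, le_div_iff₀ hs0]
    linarith

/-- Strong duality for a conic program with trivial recession cone: if no feasible `x ∈ K` has an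
objective value of at least `c₀`, then some dual feasible `lam` has a value of at most `c₀`. -/
lemma exists_dual_le (K : ConvexCone ℝ E) (hK : IsClosed (K : Set E)) (h0 : (0 : E) ∈ K)
    (a : κ → E →ₗ[ℝ] ℝ) (c : E →ₗ[ℝ] ℝ) (r : κ → ℝ) (c₀ : ℝ)
    (h : ∀ x ∈ K, (∀ k, a k x ≤ 0) → 0 ≤ c x → x = 0)
    (hno : ∀ x ∈ K, (∀ k, a k x ≤ r k) → c x < c₀) :
    ∃ lam : κ → ℝ, (∀ k, 0 ≤ lam k) ∧ ∑ k, lam k * r k ≤ c₀ ∧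
      ∀ x ∈ K, c x ≤ ∑ k, lam k * a k x := by
  -- homogenize: the pair `(x, t)` with `0 ≤ t` stands for the point `x / t`
  let K' : ConvexCone ℝ (E × ℝ) :=
    { carrier := {y | y.1 ∈ K ∧ 0 ≤ y.2}
      smul_mem' := fun t ht y hy => ⟨K.smul_mem ht hy.1, mul_nonneg ht.le hy.2⟩
      add_mem' := fun y hy y' hy' => ⟨K.add_mem hy.1 hy'.1, add_nonneg hy.2 hy'.2⟩ }
  have hK' : IsClosed (K' : Set (E × ℝ)) :=
    (hK.preimage continuous_fst).inter (isClosed_Ici.preimage continuous_snd)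
  obtain ⟨lam, hlam, hle⟩ := exists_nonneg_forall_le_sum K' hK' ⟨h0, le_rfl⟩
    (fun k => a k ∘ₗ LinearMap.fst ℝ E ℝ - r k • LinearMap.snd ℝ E ℝ)
    (c ∘ₗ LinearMap.fst ℝ E ℝ - c₀ • LinearMap.snd ℝ E ℝ) (by
      rintro ⟨x, t⟩ ⟨hx, ht⟩ h1 h2
      simp only [LinearMap.sub_apply, LinearMap.comp_apply, LinearMap.fst_apply,
        LinearMap.smul_apply, LinearMap.snd_apply, smul_eq_mul, sub_nonpos, sub_nonneg] at h1 h2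
      change 0 ≤ t at ht
      rcases ht.eq_or_lt with rfl | ht
      · rw [h x hx (by simpa using h1) (by simpa using h2)]
        rfl
      · have h3 := hno (t⁻¹ • x) (K.smul_mem (inv_pos.mpr ht) hx) (fun k => by
          rw [map_smul, smul_eq_mul, inv_mul_le_iff₀ ht, mul_comm]
          exact h1 k)
        rw [map_smul, smul_eq_mul, inv_mul_lt_iff₀ ht] at h3
        linarith)
  refine ⟨lam, hlam, ?_, fun x hx => ?_⟩
  · simpa using hle (0, 1) ⟨h0, zero_le_one⟩
  · simpa using hle (x, 0) ⟨hx, le_rfl⟩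

end Cone

/-! ### Positive semidefinite matrices and traces -/

lemma trace_mul_nonneg_of_posSemidef {n : Type*} [Fintype n] {A B : Matrix n n ℝ}
    (hA : A.PosSemidef) (hB : B.PosSemidef) : 0 ≤ (A * B).trace := by
  classical
  obtain ⟨m, v, rfl⟩ := Matrix.posSemidef_iff_eq_sum_vecMulVec.mp hA
  rw [Finset.sum_mul, Matrix.trace_sum]
  refine Finset.sum_nonneg fun i _ => ?_
  rw [Matrix.vecMulVec_mul, Matrix.trace_vecMulVec, dotProduct_comm,
    ← Matrix.dotProduct_mulVec]
  exact hB.dotProduct_mulVec_nonneg (v i)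

lemma isClosed_setOf_posSemidef {n : Type*} [Fintype n] :
    IsClosed {G : Matrix n n ℝ | G.PosSemidef} := by
  simp only [Matrix.posSemidef_iff_dotProduct_mulVec, Matrix.IsHermitian, ofPred_and, ofPred_forall]
  refine IsClosed.inter (isClosed_eq (by fun_prop) (by fun_prop)) (isClosed_iInter fun x => ?_)
  exact isClosed_le (by fun_prop) (by fun_prop)

lemma tendsto_trace_mul {ι n : Type*} [Fintype n] {l : Filter ι} {A B : ι → Matrix n n ℝ}
    {A₀ B₀ : Matrix n n ℝ} (hA : Tendsto A l (𝓝 A₀)) (hB : Tendsto B l (𝓝 B₀)) :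
    Tendsto (fun i => (A i * B i).trace) l (𝓝 (A₀ * B₀).trace) :=
  ((Continuous.matrix_trace continuous_id).tendsto _).comp (hA.mul hB)

/-! ### The primal program on a closed cone -/

section Program

-- a norm that induces the product topology on matrices, for boundedness arguments on `(F, G)`
attribute [local instance] Matrix.normedAddCommGroup Matrix.normedSpace

/-- The space of the primal variables `(F, G)`. -/
abbrev PrimalVar (N : ℕ) : Type := (Fin (N + 1) → ℝ) × Mat N

/-- The constraint functionals of the primal program: `Tr (A_{i,j} G) - F ⬝ (μ_i u_i - μ_j u_j)`
for the pair `(i, j)`, and `Tr (A_R G)` for `none`. -/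
def Data.con (D : Data N) (α : Steps N) : Option (Idx N × Idx N) → PrimalVar N →ₗ[ℝ] ℝ
  | none => Matrix.traceLinearMap _ ℝ ℝ ∘ₗ LinearMap.mulLeft ℝ D.AR ∘ₗ LinearMap.snd ℝ _ _
  | some p => Matrix.traceLinearMap _ ℝ ℝ ∘ₗ LinearMap.mulLeft ℝ (D.A α p.1 p.2) ∘ₗ
        LinearMap.snd ℝ _ _ -
      (dotProductBilin ℝ ℝ).flip (D.μ p.1 • fvec p.1 - D.μ p.2 • fvec p.2) ∘ₗ LinearMap.fst ℝ _ _

/-- The right-hand sides of the constraints `Data.con`. -/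
def Data.rhs (D : Data N) : Option (Idx N × Idx N) → ℝ
  | none => D.R ^ 2
  | some _ => 0

/-- The objective of the primal program as a linear functional. -/
def Data.objLin (D : Data N) : PrimalVar N →ₗ[ℝ] ℝ :=
  dotProductBilin ℝ ℝ D.b ∘ₗ LinearMap.fst ℝ _ _ +
    Matrix.traceLinearMap _ ℝ ℝ ∘ₗ LinearMap.mulLeft ℝ D.C ∘ₗ LinearMap.snd ℝ _ _

@[simp]
lemma Data.con_none (D : Data N) (α : Steps N) (x : PrimalVar N) :
    D.con α none x = (D.AR * x.2).trace := rfl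

@[simp]
lemma Data.con_some (D : Data N) (α : Steps N) (i j : Idx N) (x : PrimalVar N) :
    D.con α (some (i, j)) x =
      (D.A α i j * x.2).trace - x.1 ⬝ᵥ (D.μ i • fvec i - D.μ j • fvec j) := rfl

lemma Data.objLin_apply (D : Data N) (x : PrimalVar N) : D.objLin x = D.primalObj x.1 x.2 := rfl

lemma Data.primalFeasible_iff (D : Data N) (α : Steps N) (x : PrimalVar N) :
    D.PrimalFeasible α x.1 x.2 ↔ x.2.PosSemidef ∧ ∀ k, D.con α k x ≤ D.rhs k := by
  refine ⟨fun h => ⟨h.psd, ?_⟩, fun h => ⟨fun i j => ?_, h.2 none, h.1⟩⟩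
  · rintro (_ | ⟨i, j⟩)
    · exact h.init
    · exact sub_nonpos.mpr (h.interp i j)
  · exact sub_nonpos.mp (h.2 (some (i, j)))

/-- The cone of the pairs `(F, G)` with `G ⪰ 0` and `F_i = 0` whenever `μ_i = 0`. The primal
constraints involve `F` only through the products `μ_i F_i`, so this restriction removes the
directions along which the feasible set is invariant. -/
def Data.dom (D : Data N) : ConvexCone ℝ (PrimalVar N) where
  carrier := {x | (∀ i, D.μ (some i) = 0 → x.1 i = 0) ∧ x.2.PosSemidef}
  smul_mem' t ht x hx := ⟨fun i hi => by simp [hx.1 i hi], hx.2.smul ht.le⟩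
  add_mem' x hx y hy := ⟨fun i hi => by simp [hx.1 i hi, hy.1 i hi], hx.2.add hy.2⟩

lemma Data.isClosed_dom (D : Data N) : IsClosed (D.dom : Set (PrimalVar N)) := by
  have h1 : IsClosed {x : PrimalVar N | ∀ i, D.μ (some i) = 0 → x.1 i = 0} := by
    simp only [ofPred_forall]
    exact isClosed_iInter fun i => isClosed_iInter fun _ => isClosed_eq (by fun_prop) (by fun_prop)
  exact h1.inter (isClosed_setOf_posSemidef.preimage continuous_snd)

lemma Data.zero_mem_dom (D : Data N) : (0 : PrimalVar N) ∈ D.dom :=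
  ⟨fun _ _ => rfl, Matrix.PosSemidef.zero⟩

/-- The vector `F` with the coordinates that the primal constraints do not see, those with `μ_i = 0`,
replaced by zero. -/
def Data.reduce (D : Data N) (F : Fin (N + 1) → ℝ) : Fin (N + 1) → ℝ :=
  fun i => if D.μ (some i) = 0 then 0 else F i

lemma Data.reduce_dotProduct (D : Data N) (F : Fin (N + 1) → ℝ) {w : Fin (N + 1) → ℝ}
    (hw : ∀ i, D.μ (some i) = 0 → w i = 0) : D.reduce F ⬝ᵥ w = F ⬝ᵥ w := by
  refine Finset.sum_congr rfl fun i _ => ?_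
  by_cases h : D.μ (some i) = 0
  · simp [hw i h]
  · simp [Data.reduce, h]

lemma Data.smul_fvec_apply_eq_zero (D : Data N) {k : Fin (N + 1)} (hk : D.μ (some k) = 0)
    (i : Idx N) : (D.μ i • fvec i : Fin (N + 1) → ℝ) k = 0 := by
  rcases i with _ | i
  · simp [fvec]
  · rcases eq_or_ne k i with rfl | h
    · simp [hk]
    · simp [fvec, h]

lemma Data.DualFeasible.b_apply_eq_zero {D : Data N} {α : Steps N} {τ : ℝ}
    {lam : Idx N → Idx N → ℝ} (h : D.DualFeasible α τ lam) {k : Fin (N + 1)}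
    (hk : D.μ (some k) = 0) : D.b k = 0 := by
  have h1 := congrFun (sub_eq_zero.mp h.eq) k
  rw [h1]
  simp only [Finset.sum_apply]
  refine Finset.sum_eq_zero fun i _ => Finset.sum_eq_zero fun j _ => ?_
  have h2 := D.smul_fvec_apply_eq_zero hk i
  have h3 := D.smul_fvec_apply_eq_zero hk j
  rw [Pi.smul_apply, Pi.sub_apply, h2, h3]
  simp

lemma Data.PrimalFeasible.reduce {D : Data N} {α : Steps N} {F : Fin (N + 1) → ℝ} {G : Mat N}
    (h : D.PrimalFeasible α F G) : D.PrimalFeasible α (D.reduce F) G :=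
  ⟨fun i j => by
    rw [D.reduce_dotProduct F fun k hk => by
      rw [Pi.sub_apply, D.smul_fvec_apply_eq_zero hk, D.smul_fvec_apply_eq_zero hk, sub_zero]]
    exact h.interp i j, h.init, h.psd⟩

lemma Data.primalObj_reduce (D : Data N) (hb : ∀ k, D.μ (some k) = 0 → D.b k = 0)
    (F : Fin (N + 1) → ℝ) (G : Mat N) : D.primalObj (D.reduce F) G = D.primalObj F G := by
  rw [Data.primalObj, Data.primalObj, dotProduct_comm, D.reduce_dotProduct F hb, dotProduct_comm]

lemma differentiable_hvec_apply (i : Idx N) (r : Fin (N + 2)) :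
    Differentiable ℝ fun α : Steps N => hvec α i r := by
  rcases i with _ | i
  · simp [hvec]
  · refine Fin.lastCases ?_ (fun k => ?_) r
    · simp [hvec]
    · by_cases hk : k < i
      · simp only [hvec, Fin.snoc_castSucc, hk, dite_true]
        fun_prop
      · simp [hvec, hk]

lemma Data.differentiable_A_apply (D : Data N) (i j : Idx N) (r s : Fin (N + 2)) :
    Differentiable ℝ fun α : Steps N => D.A α i j r s := by
  have h := fun (i : Idx N) r => differentiable_hvec_apply i r
  simp only [Data.A, Data.Z, Matrix.smul_apply, Matrix.add_apply, Matrix.transpose_apply,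
    Matrix.vecMulVec_apply, smul_eq_mul]
  fun_prop

lemma Data.differentiable_calA_apply (D : Data N) (τ : ℝ) (lam : Idx N → Idx N → ℝ)
    (r s : Fin (N + 2)) : Differentiable ℝ fun α : Steps N => D.calA τ lam α r s := by
  have h := fun i j => D.differentiable_A_apply i j r s
  simp only [Data.calA, Matrix.add_apply, Matrix.sub_apply, Matrix.sum_apply, Matrix.smul_apply,
    smul_eq_mul]
  fun_prop

lemma Data.continuous_con (D : Data N) (k : Option (Idx N × Idx N)) :
    Continuous fun q : Steps N × PrimalVar N => D.con q.1 k q.2 := by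
  rcases k with _ | ⟨i, j⟩
  · simp only [Data.con_none]
    fun_prop
  · have h : Continuous fun α : Steps N => D.A α i j :=
      continuous_matrix fun r s => (D.differentiable_A_apply i j r s).continuous
    simp only [Data.con_some]
    fun_prop

lemma Data.continuous_objLin (D : Data N) : Continuous D.objLin :=
  D.objLin.continuous_of_finiteDimensional

/-- Uniqueness of the optimal Gram matrix makes the recession cone of the superlevel sets of the
primal program trivial: a recession direction can be added to an optimal solution, hence has no
`G`-part, and then the constraints for `(i, *)` and `(*, i)` force `μ_i F_i = 0`. -/
lemma Data.eq_zero_of_recession (D : Data N) {α : Steps N} {G : Mat N}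
    (hG : D.IsUniqueOptimalGram α G) {x : PrimalVar N} (hx : x ∈ D.dom)
    (hcon : ∀ k, D.con α k x ≤ 0) (hobj : 0 ≤ D.objLin x) : x = 0 := by
  obtain ⟨⟨F, hF⟩, huniq⟩ := hG
  have h1 : D.IsPrimalSolution α (F + x.1) (G + x.2) := by
    refine ⟨(D.primalFeasible_iff α ((F, G) + x)).mpr ⟨hF.1.psd.add hx.2, fun k => ?_⟩, ?_⟩
    · have h3 := ((D.primalFeasible_iff α (F, G)).mp hF.1).2 k
      have h4 := hcon k
      rw [map_add]
      linarith
    · intro F' G' h'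
      have h3 := hF.2 F' G' h'
      have h4 : D.primalObj (F + x.1) (G + x.2) = D.primalObj F G + D.objLin x :=
        D.objLin.map_add (F, G) x
      linarith
  have hx2 : x.2 = 0 := by simpa using huniq _ _ h1
  have hx1 : x.1 = 0 := by
    funext i
    have h3 := hcon (some (some i, none))
    have h4 := hcon (some (none, some i))
    simp only [Data.con_some, hx2, mul_zero, Matrix.trace_zero, fvec, smul_zero, sub_zero,
      zero_sub, dotProduct_smul, dotProduct_single, mul_one, smul_eq_mul, dotProduct_neg] at h3 h4
    rcases mul_eq_zero.mp (le_antisymm (by linarith : D.μ (some i) * x.1 i ≤ 0) (by linarith))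
      with h5 | h5
    · exact hx.1 i h5
    · exact h5
  exact Prod.ext hx1 hx2

/-! ### Duality -/

lemma Data.trace_calA_mul (D : Data N) (τ : ℝ) (lam : Idx N → Idx N → ℝ) (α : Steps N)
    (G : Mat N) : (D.calA τ lam α * G).trace =
      τ * (D.AR * G).trace - (D.C * G).trace + ∑ i, ∑ j, lam i j * (D.A α i j * G).trace := by
  simp [Data.calA, add_mul, sub_mul, Finset.sum_mul, Matrix.trace_sum]

/-- The Lagrangian bound. Only the linear conditions on the multipliers enter, so they may be dual
feasible for other step sizes than `α`. -/
lemma Data.PrimalFeasible.primalObj_add_trace_le {D : Data N} {α : Steps N}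
    {F : Fin (N + 1) → ℝ} {G : Mat N} (h : D.PrimalFeasible α F G) {τ : ℝ}
    {lam : Idx N → Idx N → ℝ}
    (heq : D.b - ∑ i, ∑ j, lam i j • (D.μ j • fvec j - D.μ i • fvec i) = 0)
    (hlam : ∀ i j, 0 ≤ lam i j) (hτ : 0 ≤ τ) :
    D.primalObj F G + (D.calA τ lam α * G).trace ≤ τ * D.R ^ 2 := by
  have h1 : D.b ⬝ᵥ F =
      -∑ i, ∑ j, lam i j * (F ⬝ᵥ (D.μ i • fvec i - D.μ j • fvec j)) := by
    rw [sub_eq_zero.mp heq, dotProduct_comm]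
    simp only [dotProduct_sum, ← Finset.sum_neg_distrib]
    refine Finset.sum_congr rfl fun i _ => Finset.sum_congr rfl fun j _ => ?_
    rw [dotProduct_smul, ← neg_sub, dotProduct_neg, smul_eq_mul, mul_neg]
  have h2 : ∑ i, ∑ j, lam i j * (D.A α i j * G).trace ≤
      ∑ i, ∑ j, lam i j * (F ⬝ᵥ (D.μ i • fvec i - D.μ j • fvec j)) :=
    Finset.sum_le_sum fun i _ => Finset.sum_le_sum fun j _ =>
      mul_le_mul_of_nonneg_left (h.interp i j) (hlam i j)
  have h3 := mul_le_mul_of_nonneg_left h.init hτ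
  rw [D.trace_calA_mul, Data.primalObj, h1]
  linarith

lemma Data.wSDP_le_wDual (D : Data N) (α : Steps N) : D.wSDP α ≤ D.wDual α := by
  refine iSup_le fun F => iSup_le fun G => iSup_le fun h => ?_
  refine le_iInf fun τ => le_iInf fun lam => le_iInf fun h' => ?_
  have h1 := h.primalObj_add_trace_le h'.eq h'.lam_nonneg h'.tau_nonneg
  have h2 := trace_mul_nonneg_of_posSemidef h'.psd h.psd
  exact EReal.coe_le_coe_iff.mpr (by linarith)

lemma Data.isHermitian_calA (D : Data N) (hC : D.C.IsSymm) (hAR : D.AR.IsSymm) (τ : ℝ)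
    (lam : Idx N → Idx N → ℝ) (α : Steps N) : (D.calA τ lam α).IsHermitian := by
  have hA : ∀ i j, (D.A α i j)ᵀ = D.A α i j := fun i j => by
    simp [Data.A, add_comm]
  rw [Matrix.IsHermitian, Matrix.conjTranspose_eq_transpose_of_trivial]
  simp [Data.calA, Matrix.transpose_sum, hC.eq, hAR.eq, hA]

/-- Absence of a duality gap at step sizes for which the primal recession cone is trivial. -/
lemma Data.wDual_le_wSDP (D : Data N) (hC : D.C.IsSymm) (hAR : D.AR.IsSymm)
    (hb : ∀ k, D.μ (some k) = 0 → D.b k = 0) {α : Steps N}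
    (hrec : ∀ x ∈ D.dom, (∀ k, D.con α k x ≤ 0) → 0 ≤ D.objLin x → x = 0) :
    D.wDual α ≤ D.wSDP α := by
  refine EReal.le_of_forall_lt_iff_le.mp fun c₀ hc₀ => ?_
  obtain ⟨lam, hlam, hval, hle⟩ := exists_dual_le D.dom D.isClosed_dom D.zero_mem_dom (D.con α)
    D.objLin D.rhs c₀ hrec (by
      intro x hx hk
      have hf := (D.primalFeasible_iff α x).mpr ⟨hx.2, hk⟩
      have h1 : ((D.primalObj x.1 x.2 : ℝ) : EReal) ≤ D.wSDP α :=
        le_iSup_of_le x.1 (le_iSup_of_le x.2 (le_iSup_of_le hf le_rfl))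
      exact EReal.coe_lt_coe_iff.mp (h1.trans_lt hc₀))
  replace hle : ∀ x ∈ D.dom, D.primalObj x.1 x.2 ≤ lam none * (D.AR * x.2).trace +
      ∑ i, ∑ j, lam (some (i, j)) *
        ((D.A α i j * x.2).trace - x.1 ⬝ᵥ (D.μ i • fvec i - D.μ j • fvec j)) := fun x hx => by
    have h1 := hle x hx
    rwa [Fintype.sum_option, Fintype.sum_prod_type] at h1
  have hfeas : D.DualFeasible α (lam none) fun i j => lam (some (i, j)) := by
    refine ⟨.of_dotProduct_mulVec_nonneg (D.isHermitian_calA hC hAR _ _ _) fun v => ?_, ?_,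
      fun i j => hlam _, hlam _⟩
    · have h1 := hle (0, Matrix.vecMulVec v (star v))
        ⟨fun _ _ => rfl, Matrix.posSemidef_vecMulVec_self_star v⟩
      have h2 := D.trace_calA_mul (lam none) (fun i j => lam (some (i, j))) α
        (Matrix.vecMulVec v (star v))
      simp only [Data.primalObj, dotProduct_zero, zero_dotProduct, sub_zero] at h1
      rw [Matrix.mul_vecMulVec, Matrix.trace_vecMulVec, dotProduct_comm] at h2
      linarith
    · set w := D.b - ∑ i, ∑ j, lam (some (i, j)) • (D.μ j • fvec j - D.μ i • fvec i) with hw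
      have hwz : ∀ k, D.μ (some k) = 0 → w k = 0 := by
        intro k hk
        simp only [hw, Pi.sub_apply, Finset.sum_apply, hb k hk, zero_sub, neg_eq_zero]
        refine Finset.sum_eq_zero fun i _ => Finset.sum_eq_zero fun j _ => ?_
        rw [Pi.smul_apply, Pi.sub_apply, D.smul_fvec_apply_eq_zero hk,
          D.smul_fvec_apply_eq_zero hk]
        simp
      have h1 := hle (w, 0) ⟨hwz, Matrix.PosSemidef.zero⟩
      have h2 : w ⬝ᵥ w = D.b ⬝ᵥ w +
          ∑ i, ∑ j, lam (some (i, j)) * (w ⬝ᵥ (D.μ i • fvec i - D.μ j • fvec j)) := by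
        refine (congrArg (w ⬝ᵥ ·) hw).trans ?_
        rw [dotProduct_sub, dotProduct_comm _ D.b, sub_eq_add_neg]
        simp only [dotProduct_sum, ← Finset.sum_neg_distrib]
        refine congrArg _ (Finset.sum_congr rfl fun i _ => Finset.sum_congr rfl fun j _ => ?_)
        rw [dotProduct_smul, ← neg_sub (D.μ i • _), dotProduct_neg, smul_eq_mul, mul_neg, neg_neg]
      simp only [Data.primalObj, mul_zero, Matrix.trace_zero, add_zero, zero_sub, mul_neg,
        Finset.sum_neg_distrib] at h1
      exact dotProduct_self_eq_zero.mp (le_antisymm (by linarith)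
        (Finset.sum_nonneg fun k _ => mul_self_nonneg _))
  refine iInf_le_of_le (lam none) (iInf_le_of_le (fun i j => lam (some (i, j)))
    (iInf_le_of_le hfeas (EReal.coe_le_coe_iff.mpr ?_)))
  simpa only [Fintype.sum_option, Data.rhs, mul_zero, Finset.sum_const_zero, add_zero] using hval

/-- Near `α` there is no duality gap, because triviality of the primal recession cone is an open
condition on the step sizes. -/
lemma Data.eventually_wSDP_eq_wDual (D : Data N) (hC : D.C.IsSymm) (hAR : D.AR.IsSymm)
    (hb : ∀ k, D.μ (some k) = 0 → D.b k = 0) {α : Steps N} {G : Mat N}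
    (hG : D.IsUniqueOptimalGram α G) : ∀ᶠ a in 𝓝 α, D.wSDP a = D.wDual a := by
  obtain ⟨δ, hδ, hco⟩ := exists_mul_norm_le_excess D.dom D.isClosed_dom D.con (fun _ => D.objLin)
    D.continuous_con (D.continuous_objLin.comp continuous_snd) α
    (fun x hx => D.eq_zero_of_recession hG hx)
  filter_upwards [hco] with a ha
  refine le_antisymm (D.wSDP_le_wDual a) (D.wDual_le_wSDP hC hAR hb fun x hx h1 h2 => ?_)
  have h3 : excess (fun k => D.con a k x) (D.objLin x) = 0 := by
    simp [excess, h1, h2]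
  have h4 := ha x hx
  rw [h3] at h4
  exact norm_le_zero_iff.mp (nonpos_of_mul_nonpos_right h4 hδ)

/-! ### The directional derivative of the optimal value -/

lemma Data.IsDualSolution.wDual_eq {D : Data N} {α : Steps N} {τ : ℝ} {lam : Idx N → Idx N → ℝ}
    (h : D.IsDualSolution α τ lam) : D.wDual α = ((τ * D.R ^ 2 : ℝ) : EReal) := by
  refine le_antisymm (iInf_le_of_le τ (iInf_le_of_le lam (iInf_le _ h.1))) ?_
  exact le_iInf fun τ' => le_iInf fun lam' => le_iInf fun h' =>
    EReal.coe_le_coe_iff.mpr (h.2 τ' lam' h')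

lemma Data.exists_mem_dom_lt_primalObj (D : Data N) (hb : ∀ k, D.μ (some k) = 0 → D.b k = 0)
    {α : Steps N} {c : ℝ} (hc : (c : EReal) < D.wSDP α) :
    ∃ x ∈ D.dom, (∀ k, D.con α k x ≤ D.rhs k) ∧ c < D.objLin x := by
  simp only [Data.wSDP, lt_iSup_iff] at hc
  obtain ⟨F, G, h, hc⟩ := hc
  have h1 := (D.primalFeasible_iff α (D.reduce F, G)).mp h.reduce
  refine ⟨(D.reduce F, G), ⟨fun i hi => by simp [Data.reduce, hi], h1.1⟩, h1.2, ?_⟩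
  rw [D.objLin_apply, D.primalObj_reduce hb]
  exact EReal.coe_lt_coe_iff.mp hc

/-- One half of the derivative formula. A nearly optimal Gram matrix `G'` at the step sizes
`α + s d` bounds the increase of the optimal value by `-Tr ((𝒜(α + s d) - 𝒜(α)) G')` up to an
error `s ^ 2`, and `G'` tends to the unique optimal `G` as `s → 0+`. -/
lemma Data.deriv_wDual_le (D : Data N) {α : Steps N} {G : Mat N}
    (hG : D.IsUniqueOptimalGram α G) {τ : ℝ} {lam : Idx N → Idx N → ℝ}
    (hdual : D.IsDualSolution α τ lam)
    (hfin : ∀ᶠ a in 𝓝 α, D.wSDP a = ((D.wDual a).toReal : EReal)) (d : Steps N) {w' : ℝ}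
    (hw : HasDerivAt (fun t : ℝ => (D.wDual (α + t • d)).toReal) w' 0) {M : Mat N}
    (hM : ∀ r s, HasDerivAt (fun t : ℝ => D.calA τ lam (α + t • d) r s) (M r s) 0) :
    w' ≤ -(M * G).trace := by
  have hb : ∀ k, D.μ (some k) = 0 → D.b k = 0 := fun k => hdual.1.b_apply_eq_zero
  set w : Steps N → ℝ := fun a => (D.wDual a).toReal with hwdef
  have hwα : w α = τ * D.R ^ 2 := by
    rw [hwdef]
    simp only [hdual.wDual_eq, EReal.toReal_coe]
  have hline : Continuous fun t : ℝ => α + t • d := by fun_prop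
  have hline0 : Tendsto (fun t : ℝ => α + t • d) (𝓝 0) (𝓝 α) := by
    simpa using hline.tendsto 0
  obtain ⟨ε, hε, hgood⟩ := Metric.eventually_nhds_iff.mp (hline0.eventually hfin)
  -- positive parameters below `ε` that tend to zero
  let t : ℕ → ℝ := fun n => ε * (1 / ((n : ℝ) + 1)) / 2
  have ht0 : ∀ n, 0 < t n := fun n => by positivity
  have htε : ∀ n, t n < ε := fun n => by
    have h1 : 1 / ((n : ℝ) + 1) ≤ 1 := by
      rw [div_le_one (by positivity)]
      linarith [n.cast_nonneg (α := ℝ)]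
    have h2 := mul_le_mul_of_nonneg_left h1 hε.le
    simp only [t]
    linarith
  have htt : Tendsto t atTop (𝓝 0) := by
    simpa [t] using (tendsto_one_div_add_atTop_nhds_zero_nat.const_mul ε).div_const (2 : ℝ)
  have htt' : Tendsto t atTop (𝓝[≠] 0) :=
    tendsto_nhdsWithin_iff.mpr ⟨htt, Eventually.of_forall fun n => (ht0 n).ne'⟩
  let a : ℕ → Steps N := fun n => α + t n • d
  have hat : Tendsto a atTop (𝓝 α) := hline0.comp htt
  have hval : ∀ n, D.wSDP (a n) = (w (a n) : EReal) := fun n =>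
    hgood (by rw [Real.dist_0_eq_abs, abs_of_pos (ht0 n)]; exact htε n)
  have hwt : Tendsto (fun n => w (a n)) atTop (𝓝 (w α)) := by
    simpa [Function.comp_def, a, hwdef] using hw.continuousAt.tendsto.comp htt
  have hx : ∀ n, ∃ x ∈ D.dom, (∀ k, D.con (a n) k x ≤ D.rhs k) ∧
      w (a n) - t n ^ 2 < D.objLin x := fun n => by
    refine D.exists_mem_dom_lt_primalObj hb ?_
    rw [hval n]
    exact EReal.coe_lt_coe_iff.mpr (sub_lt_self _ (pow_pos (ht0 n) 2))
  choose x hxK hxcon hxobj using hx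
  have hct : Tendsto (fun n => w (a n) - t n ^ 2) atTop (𝓝 (w α)) := by
    simpa using hwt.sub (htt.pow 2)
  obtain ⟨δ, hδ, hco⟩ := exists_mul_norm_le_excess D.dom D.isClosed_dom D.con (fun _ => D.objLin)
    D.continuous_con (D.continuous_objLin.comp continuous_snd) α
    (fun x hx => D.eq_zero_of_recession hG hx)
  have hexc : Continuous fun c : ℝ => excess D.rhs c :=
    continuous_excess (fun k => continuous_const) continuous_id
  obtain ⟨x₀, hx₀, φ, hφ, hxt⟩ := exists_tendsto_subseq_of_excess_le D.dom D.isClosed_dom D.con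
    (fun _ => D.objLin) hδ hco hat hxK ((hexc.tendsto _).comp hct)
    (fun n => excess_mono (hxcon n) (hxobj n).le)
  have hφt := hφ.tendsto_atTop
  -- the limit point is optimal at `α`, so its Gram matrix is `G`
  have hopt : D.IsPrimalSolution α x₀.1 x₀.2 := by
    refine ⟨(D.primalFeasible_iff α x₀).mpr ⟨hx₀.2, fun k => ?_⟩, fun F' G' h' => ?_⟩
    · exact le_of_tendsto (((D.continuous_con k).tendsto (α, x₀)).comp
        ((hat.comp hφt).prodMk_nhds hxt)) (Eventually.of_forall fun n => hxcon (φ n) k)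
    · have h1 : w α ≤ D.objLin x₀ := le_of_tendsto_of_tendsto' (hct.comp hφt)
        ((D.continuous_objLin.tendsto x₀).comp hxt) fun n => (hxobj (φ n)).le
      have h2 := h'.primalObj_add_trace_le hdual.1.eq hdual.1.lam_nonneg hdual.1.tau_nonneg
      have h3 := trace_mul_nonneg_of_posSemidef hdual.1.psd h'.psd
      rw [D.objLin_apply] at h1
      linarith
  have hGt : Tendsto (fun n => (x (φ n)).2) atTop (𝓝 G) := by
    rw [← hG.2 _ _ hopt]
    exact (continuous_snd.tendsto x₀).comp hxt
  let Q : ℕ → Mat N := fun n => (t n)⁻¹ • (D.calA τ lam (a n) - D.calA τ lam α)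
  have hQt : Tendsto Q atTop (𝓝 M) := by
    refine tendsto_pi_nhds.mpr fun r => tendsto_pi_nhds.mpr fun s => ?_
    refine ((hM r s).tendsto_slope_zero.comp htt').congr fun n => ?_
    simp [Q, a]
  have hlim : Tendsto (fun n => (Q (φ n) * (x (φ n)).2).trace) atTop (𝓝 (M * G).trace) := by
    exact tendsto_trace_mul (hQt.comp hφt) hGt
  have hslope : Tendsto (fun n => (t n)⁻¹ * (w (a n) - w α) - t n) atTop (𝓝 w') := by
    have := (hw.tendsto_slope_zero.comp htt').sub htt
    simpa [Function.comp_def, a] using this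
  refine le_of_tendsto_of_tendsto' (hslope.comp hφt) hlim.neg fun m => ?_
  set n := φ m
  have h1 := ((D.primalFeasible_iff (a n) (x n)).mpr
    ⟨(hxK n).2, hxcon n⟩).primalObj_add_trace_le hdual.1.eq hdual.1.lam_nonneg hdual.1.tau_nonneg
  have h2 := trace_mul_nonneg_of_posSemidef hdual.1.psd (hxK n).2
  have h3 : (Q n * (x n).2).trace =
      (t n)⁻¹ * ((D.calA τ lam (a n) * (x n).2).trace - (D.calA τ lam α * (x n).2).trace) := by
    simp [Q, sub_mul]
  have h4 := hxobj n
  rw [D.objLin_apply] at h4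
  have h5 := mul_inv_cancel₀ (ht0 n).ne'
  have h6 : (t n)⁻¹ * (w (a n) - w α - t n ^ 2) ≤ (t n)⁻¹ *
      -((D.calA τ lam (a n) * (x n).2).trace - (D.calA τ lam α * (x n).2).trace) :=
    mul_le_mul_of_nonneg_left (by linarith) (inv_pos.mpr (ht0 n)).le
  have h7 : (t n)⁻¹ * t n ^ 2 = t n := by field_simp
  simp only [Function.comp_apply]
  rw [h3]
  linarith

lemma HasGradient.hasDerivAt_line {f : Steps N → EReal} {v α : Steps N} (h : HasGradient f v α)
    (d : Steps N) : HasDerivAt (fun t : ℝ => (f (α + t • d)).toReal) (inner ℝ v d) 0 := by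
  have h1 : HasDerivAt (fun t : ℝ => α + t • d) d 0 := by
    simpa using ((hasDerivAt_id (0 : ℝ)).smul_const d).const_add α
  have h2 := h.2.hasFDerivAt
  rw [show α = α + (0 : ℝ) • d by simp] at h2
  simpa [Function.comp_def] using h2.comp_hasDerivAt (0 : ℝ) h1

lemma HasGradient.partialDeriv_eq {f : Steps N → EReal} {v α : Steps N} (h : HasGradient f v α)
    (p : StepIdx N) : partialDeriv (fun a => (f a).toReal) p α = v p := by
  rw [partialDeriv, (h.hasDerivAt_line _).deriv]
  simp [PiLp.inner_apply]

lemma HasGradient.toLp_partialDeriv {f : Steps N → EReal} {v α : Steps N}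
    (h : HasGradient f v α) :
    HasGradient f (WithLp.toLp 2 fun p => partialDeriv (fun a => (f a).toReal) p α) α := by
  have hv : (WithLp.toLp 2 fun p => partialDeriv (fun a => (f a).toReal) p α) = v := by
    ext p
    exact h.partialDeriv_eq p
  rwa [hv]

lemma Data.hasDerivAt_calA_apply (D : Data N) (τ : ℝ) (lam : Idx N → Idx N → ℝ) (α : Steps N)
    (p : StepIdx N) (r s : Fin (N + 2)) :
    HasDerivAt (fun t : ℝ => D.calA τ lam (α + t • EuclideanSpace.single p (1 : ℝ)) r s)
      (D.dcalA τ lam p α r s) 0 := by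
  refine DifferentiableAt.hasDerivAt ?_
  have h1 : Differentiable ℝ fun t : ℝ => α + t • EuclideanSpace.single p (1 : ℝ) := by fun_prop
  exact ((D.differentiable_calA_apply τ lam r s).comp h1) 0

end Program

end PEP

end

theorem theorem3 {N : ℕ} (D : PEP.Data N) (hC : D.C.IsSymm) (hAR : D.AR.IsSymm)
    (α : PEP.Steps N)
    (hdiff : ∃ v : PEP.Steps N, PEP.HasGradient D.wDual v α)
    (G : PEP.Mat N) (hG : D.IsUniqueOptimalGram α G)
    (τ : ℝ) (lam : PEP.Idx N → PEP.Idx N → ℝ) (hdual : D.IsDualSolution α τ lam) :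
    (PEP.HasGradient D.wDual
        (WithLp.toLp 2 fun p => PEP.partialDeriv (fun a => (D.wDual a).toReal) p α) α ∧
      ∀ p : PEP.StepIdx N,
        PEP.partialDeriv (fun a => (D.wDual a).toReal) p α =
          (-G * D.dcalA τ lam p α).trace) ∧
    (PEP.HasGradient D.wSDP
        (WithLp.toLp 2 fun p => PEP.partialDeriv (fun a => (D.wSDP a).toReal) p α) α ∧
      ∀ p : PEP.StepIdx N,
        PEP.partialDeriv (fun a => (D.wSDP a).toReal) p α =
          (-G * D.dcalA τ lam p α).trace) := by
  obtain ⟨v, hv⟩ := hdiff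
  have hgap := D.eventually_wSDP_eq_wDual hC hAR (fun k => hdual.1.b_apply_eq_zero) hG
  have hfin : ∀ᶠ a in 𝓝 α, D.wSDP a = ((D.wDual a).toReal : EReal) := by
    filter_upwards [hgap, hv.1] with a ha hva
    rw [ha, EReal.coe_toReal hva.2 hva.1]
  have hvS : PEP.HasGradient D.wSDP v α := by
    refine ⟨?_, hv.2.congr_of_eventuallyEq (hgap.mono fun a ha => congrArg EReal.toReal ha)⟩
    filter_upwards [hgap, hv.1] with a ha hva
    rwa [ha]
  have hval : ∀ p, v p = (-G * D.dcalA τ lam p α).trace := by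
    intro p
    have hd := hv.hasDerivAt_line (EuclideanSpace.single p (1 : ℝ))
    have hM := D.hasDerivAt_calA_apply τ lam α p
    have hvp : inner ℝ v (EuclideanSpace.single p (1 : ℝ)) = v p := by
      simp [PiLp.inner_apply]
    have h1 := D.deriv_wDual_le hG hdual hfin _ hd hM
    -- the opposite direction gives the reverse inequality
    have h2 := D.deriv_wDual_le hG hdual hfin (-EuclideanSpace.single p (1 : ℝ)) (w' := -v p)
      (M := -D.dcalA τ lam p α)
      (by simpa [hvp] using hv.hasDerivAt_line (-EuclideanSpace.single p (1 : ℝ)))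
      (fun r s => by
        have h3 : HasDerivAt (fun t : ℝ => -t) (-1) 0 := hasDerivAt_neg 0
        have h4 := hM r s
        rw [show (0 : ℝ) = -0 by simp] at h4
        simpa [Function.comp_def] using h4.comp (0 : ℝ) h3)
    rw [hvp] at h1
    rw [neg_mul, Matrix.trace_neg, neg_neg] at h2
    rw [neg_mul, Matrix.trace_neg, Matrix.trace_mul_comm]
    linarith
  exact ⟨⟨hv.toLp_partialDeriv, fun p => (hv.partialDeriv_eq p).trans (hval p)⟩,
    hvS.toLp_partialDeriv, fun p => (hvS.partialDeriv_eq p).trans (hval p)⟩
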